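/- Let $p, K^* \in \mathbb{N}$ with $K^* \ge 1$, let $M > 0$, let $\mathcal{Y} \subset \mathbb{R}^{K^*}$ be a closed set, and let $f_* : [-M,M]^p \to \mathcal{Y}$ be continuous. A kernel on $\mathcal{Y}^2$ is a symmetric continuous function $g : \mathcal{Y}^2 \to \mathbb{R}$; it is positive definite (PD) if $\sum_{i=1}^n \sum_{j=1}^n c_i c_j g(y_i,y_j) \ge 0$ for all $n$, all $c_1,\dots,c_n \in \mathbb{R}$ and all $y_1,\dots,y_n \in \mathcal{Y}$. Let $g_*$ be a kernel on $\mathcal{Y}^2$ that is dominated by some PD kernel $g$ on $\mathcal{Y}^2$, i.e. $g - g_*$ is PD. Let $\sigma : \mathbb{R} \to \mathbb{R}$ be either the ReLU function $t \mapsto \max(t,0)$ or a non-constant, continuous, bounded, monotonically increasing (i.e. non-decreasing) function, and let $\boldsymbol\sigma$ denote its element-wise application to vectors. Then for every $\varepsilon > 0$, for all sufficiently large $K_+, K_- \in \mathbb{N}$, all sufficiently large $T_+ \in \mathbb{N}$ (depending on $K_+$) and all sufficiently large $T_- \in \mathbb{N}$ (depending on $K_-$), there exist $A \in \mathbb{R}^{K_+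 \times T_+}$, $B \in \mathbb{R}^{T_+ \times p}$, $c \in \mathbb{R}^{T_+}$, $E \in \mathbb{R}^{K_- \times T_-}$, $F \in \mathbb{R}^{T_- \times p}$, $o \in \mathbb{R}^{T_-}$ such that the two-layer neural networks $f_\psi(x) = A\,\boldsymbol\sigma(Bx + c) \in \mathbb{R}^{K_+}$ and $r_\zeta(x) = E\,\boldsymbol\sigma(Fx + o) \in \mathbb{R}^{K_-}$ satisfy $$\Big| g_*\big(f_*(x), f_*(x')\big) - \big( \langle f_\psi(x), f_\psi(x') \rangle - \langle r_\zeta(x), r_\zeta(x') \rangle \big) \Big| < \varepsilon \quad \text{for all } (x,x') \in [-M,M]^{2p}.$$ -/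

import Mathlib

open scoped Matrix

/-- A kernel on `Y × Y`: a symmetric (jointly) continuous real-valued function. -/
structure IsKernel {Y : Type*} [TopologicalSpace Y] (g : Y → Y → ℝ) : Prop where
  symm : ∀ y y' : Y, g y y' = g y' y
  cont : Continuous (fun q : Y × Y => g q.1 q.2)

/-- A positive definite (PD) kernel: a kernel all of whose quadratic forms
`∑ i, ∑ j, c i * c j * g (y i) (y j)` are nonnegative. -/
structure IsPDKernel {Y : Type*} [TopologicalSpace Y] (g : Y → Y → ℝ) : Prop
    extends IsKernel g where
  nonneg : ∀ (n : ℕ) (c : Fin n → ℝ) (y : Fin n → Y),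
    0 ≤ ∑ i, ∑ j, c i * c j * g (y i) (y j)

/-- `h` is dominated by some PD kernel `g`, i.e. `g - h` is a PD kernel. -/
def IsPDDominated {Y : Type*} [TopologicalSpace Y] (h : Y → Y → ℝ) : Prop :=
  ∃ g : Y → Y → ℝ, IsPDKernel g ∧ IsPDKernel (fun y y' => g y y' - h y y')

/-- The admissible activation functions: ReLU, or any function that is non-constant, continuous,
bounded and monotonically increasing (in the weak sense). -/
def IsActivation (σ : ℝ → ℝ) : Prop :=
  (∀ t, σ t = max t 0) ∨
    ((∃ s t, σ s ≠ σ t) ∧ Continuous σ ∧ (∃ C, ∀ t, |σ t| ≤ C) ∧ Monotone σ)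

/-- The cube `[-M, M]^p`. -/
def cube (p : ℕ) (M : ℝ) : Set (Fin p → ℝ) := {x | ∀ i, x i ∈ Set.Icc (-M) M}

/-- The two-layer neural network `x ↦ A σ(B x + c)` with `p` inputs, `T` hidden units and
`K` outputs, where `σ` is applied to each coordinate. -/
def twoLayerNet {p T K : ℕ} (σ : ℝ → ℝ) (A : Matrix (Fin K) (Fin T) ℝ)
    (B : Matrix (Fin T) (Fin p) ℝ) (c : Fin T → ℝ) (x : Fin p → ℝ) : Fin K → ℝ :=
  A *ᵥ (fun t => σ ((B *ᵥ x + c) t))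

/-! Domination writes `gstar` as a difference of two PD kernels, `g` and `g - gstar`, and composing
with `fstar` moves both to the compact cube. So it suffices to approximate one PD kernel by inner
products of networks. `IsPDKernel.exists_features` averages the kernel over a fine partition of
unity and factors the resulting Gram matrix, which gives finitely many continuous features.
`exists_ridgeSpan_near` approximates each feature: Stone–Weierstrass reduces it to exponentials of
linear forms, and each exponential, as a function of one variable, is a staircase of approximate
steps built from `σ`. -/

open Filter

/-! ### Finite-rank approximation of positive definite kernels -/

/-- On a compact metric space there are finitely many nonnegative continuous functions summing
to one, the `i`-th of which vanishes at distance at least `δ` from a point `z i`. -/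
lemma exists_continuous_partition {X : Type*} [MetricSpace X] [CompactSpace X] {δ : ℝ}
    (hδ : 0 < δ) :
    ∃ (n : ℕ) (z : Fin n → X) (w : Fin n → C(X, ℝ)),
      (∀ i x, 0 ≤ w i x) ∧ (∀ x, ∑ i, w i x = 1) ∧ ∀ i x, w i x ≠ 0 → dist x (z i) < δ := by
  obtain ⟨t, -, htf, ht⟩ := finite_cover_balls_of_compact (isCompact_univ (X := X)) hδ
  let e := htf.toFinset.equivFin
  let z : Fin htf.toFinset.card → X := fun i => (e.symm i : X)
  let r : Fin htf.toFinset.card → X → ℝ := fun i x => max 0 (δ - dist x (z i))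
  have hr0 : ∀ i x, 0 ≤ r i x := fun i x => le_max_left _ _
  have hrc : ∀ i, Continuous (r i) := fun i => by fun_prop
  have hpos : ∀ x, 0 < ∑ i, r i x := by
    intro x
    have hx := ht (Set.mem_univ x)
    simp only [Set.mem_iUnion, Metric.mem_ball] at hx
    obtain ⟨y, hy, hxy⟩ := hx
    refine Finset.sum_pos' (fun i _ => hr0 i x)
      ⟨e ⟨y, htf.mem_toFinset.2 hy⟩, Finset.mem_univ _, ?_⟩
    have : z (e ⟨y, htf.mem_toFinset.2 hy⟩) = y := by simp [z]
    simp only [r, this]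
    exact lt_max_of_lt_right (by linarith)
  refine ⟨_, z, fun i => ⟨fun x => r i x / ∑ j, r j x, (hrc i).div
    (continuous_finsetSum _ fun j _ => hrc j) fun x => (hpos x).ne'⟩, ?_, ?_, ?_⟩
  · exact fun i x => div_nonneg (hr0 i x) (hpos x).le
  · intro x
    simp only [ContinuousMap.coe_mk]
    rw [← Finset.sum_div, div_self (hpos x).ne']
  · intro i x h
    by_contra hd
    apply h
    have : r i x = 0 := max_eq_left (by linarith)
    simp [this]

lemma IsPDKernel.posSemidef {X : Type*} [TopologicalSpace X] {k : X → X → ℝ} (hk : IsPDKernel k)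
    {n : ℕ} (z : Fin n → X) : (Matrix.of fun i j => k (z i) (z j)).PosSemidef := by
  refine .of_dotProduct_mulVec_nonneg ?_ fun c => ?_
  · ext i j
    exact hk.symm (z j) (z i)
  · refine (hk.nonneg n c z).trans_eq ?_
    simp only [dotProduct, Matrix.mulVec, Finset.mul_sum, star_trivial, Matrix.of_apply]
    exact Finset.sum_congr rfl fun i _ => Finset.sum_congr rfl fun j _ => by ring

lemma IsPDKernel.comp {X Y : Type*} [TopologicalSpace X] [TopologicalSpace Y] {k : Y → Y → ℝ}
    (hk : IsPDKernel k) {f : X → Y} (hf : Continuous f) :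
    IsPDKernel fun x x' => k (f x) (f x') where
  symm _ _ := hk.symm _ _
  cont := hk.cont.comp (hf.prodMap hf)
  nonneg n c z := hk.nonneg n c fun i => f (z i)

open scoped MatrixOrder in
/-- A positive definite kernel on a compact metric space is uniformly approximated by inner
products of continuous feature maps, in every sufficiently large dimension. -/
lemma IsPDKernel.exists_features {X : Type*} [MetricSpace X] [CompactSpace X] {k : X → X → ℝ}
    (hk : IsPDKernel k) {ε : ℝ} (hε : 0 < ε) :
    ∃ N : ℕ, ∀ K ≥ N, ∃ φ : Fin K → C(X, ℝ),
      ∀ x x', |k x x' - ∑ l, φ l x * φ l x'| ≤ ε := by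
  obtain ⟨δ, hδ, hkδ⟩ := Metric.uniformContinuous_iff.1
    (CompactSpace.uniformContinuous_of_continuous hk.cont) ε hε
  obtain ⟨n, z, w, hw0, hw1, hwδ⟩ := exists_continuous_partition (X := X) hδ
  -- The Gram matrix at the centres is positive semidefinite, and the columns of `B` serve as
  -- feature vectors there.
  obtain ⟨B, hB⟩ : ∃ B : Matrix (Fin n) (Fin n) ℝ,
      (Matrix.of fun i j => k (z i) (z j)) = B.conjTranspose * B := by
    have h := hk.posSemidef z
    exact CStarAlgebra.nonneg_iff_eq_star_mul_self.1 h.nonneg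
  have hBk : ∀ i j, k (z i) (z j) = ∑ l, B l i * B l j := fun i j => by
    simpa [Matrix.mul_apply] using congrFun (congrFun hB i) j
  -- Padding by zero features makes every `K ≥ n` work.
  let φ : ℕ → C(X, ℝ) := fun l => if h : l < n then ∑ i, B ⟨l, h⟩ i • w i else 0
  have hφ : ∀ (l : Fin n) x, φ l x = ∑ i, B l i * w i x := fun l x => by
    simp [φ, ContinuousMap.sum_apply]
  refine ⟨n, fun K hK => ⟨fun l => φ l, fun x x' => ?_⟩⟩
  have hsum : ∑ l : Fin K, φ l x * φ l x' = ∑ l : Fin n, φ l x * φ l x' := by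
    rw [Fin.sum_univ_eq_sum_range (fun l => φ l x * φ l x'),
      Fin.sum_univ_eq_sum_range (fun l => φ l x * φ l x')]
    refine (Finset.sum_subset (Finset.range_mono hK) fun l _ hl => ?_).symm
    simp [φ, Finset.mem_range.not.1 hl]
  have hrank : ∑ l : Fin n, φ l x * φ l x' = ∑ i, ∑ j, w i x * w j x' * k (z i) (z j) := by
    simp only [hφ, hBk, Finset.sum_mul_sum]
    simp only [Finset.mul_sum]
    rw [Finset.sum_comm]
    refine Finset.sum_congr rfl fun i _ => ?_
    rw [Finset.sum_comm]
    exact Finset.sum_congr rfl fun j _ => Finset.sum_congr rfl fun l _ => by ring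
  have hone : ∑ i, ∑ j, w i x * w j x' = 1 := by
    rw [← Finset.sum_mul_sum, hw1, hw1, one_mul]
  -- The error is a convex combination of increments of `k`, where only centres within `δ` carry
  -- weight.
  have hsplit : k x x' - ∑ l : Fin K, φ l x * φ l x'
      = ∑ i, ∑ j, w i x * w j x' * (k x x' - k (z i) (z j)) := by
    rw [hsum, hrank]
    simp only [mul_sub, Finset.sum_sub_distrib, ← Finset.sum_mul, hone, one_mul]
  rw [hsplit]
  calc |∑ i, ∑ j, w i x * w j x' * (k x x' - k (z i) (z j))|
      ≤ ∑ i, ∑ j, w i x * w j x' * ε := by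
        refine (Finset.abs_sum_le_sum_abs _ _).trans (Finset.sum_le_sum fun i _ =>
          (Finset.abs_sum_le_sum_abs _ _).trans (Finset.sum_le_sum fun j _ => ?_))
        rw [abs_mul, abs_of_nonneg (mul_nonneg (hw0 i x) (hw0 j x'))]
        by_cases h : w i x * w j x' = 0
        · simp [h]
        · have hi := hwδ i x (left_ne_zero_of_mul h)
          have hj := hwδ j x' (right_ne_zero_of_mul h)
          have := hkδ (a := (x, x')) (b := (z i, z j)) (max_lt hi hj)
          exact mul_le_mul_of_nonneg_left this.le (mul_nonneg (hw0 i x) (hw0 j x'))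
    _ = ε := by simp only [← Finset.sum_mul, hone, one_mul]

/-! ### Universal approximation by two-layer networks -/

/-- The linear span of the functions `s ↦ σ (a * s + c)`. -/
def affineSpan₁ (σ : ℝ → ℝ) : Submodule ℝ (ℝ → ℝ) :=
  Submodule.span ℝ (Set.range fun q : ℝ × ℝ => fun s => σ (q.1 * s + q.2))

/-- The linear span of the ridge functions `x ↦ σ (b ⬝ᵥ x + c)`. -/
def ridgeSpan (σ : ℝ → ℝ) (p : ℕ) : Submodule ℝ ((Fin p → ℝ) → ℝ) :=
  Submodule.span ℝ (Set.range fun q : (Fin p → ℝ) × ℝ => fun x => σ (q.1 ⬝ᵥ x + q.2))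

lemma mem_affineSpan₁ (σ : ℝ → ℝ) (a c : ℝ) : (fun s => σ (a * s + c)) ∈ affineSpan₁ σ :=
  Submodule.subset_span ⟨(a, c), rfl⟩

lemma affineSpan₁_comp {σ f : ℝ → ℝ} (hf : f ∈ affineSpan₁ σ) (a c : ℝ) :
    (fun s => f (a * s + c)) ∈ affineSpan₁ σ := by
  have : affineSpan₁ σ ≤ (affineSpan₁ σ).comap (LinearMap.funLeft ℝ ℝ fun s => a * s + c) := by
    refine Submodule.span_le.2 ?_
    rintro _ ⟨⟨b, d⟩, rfl⟩
    refine Submodule.subset_span ⟨(b * a, b * c + d), ?_⟩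
    ext s
    simp only [LinearMap.funLeft_apply]
    congr 1
    ring
  exact this hf

lemma ridgeSpan_comp {σ f : ℝ → ℝ} (hf : f ∈ affineSpan₁ σ) {p : ℕ} (b : Fin p → ℝ) :
    (fun x => f (b ⬝ᵥ x)) ∈ ridgeSpan σ p := by
  have : affineSpan₁ σ ≤
      (ridgeSpan σ p).comap (LinearMap.funLeft ℝ ℝ fun x : Fin p → ℝ => b ⬝ᵥ x) := by
    refine Submodule.span_le.2 ?_
    rintro _ ⟨⟨a, c⟩, rfl⟩
    refine Submodule.subset_span ⟨(a • b, c), ?_⟩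
    ext x
    simp [LinearMap.funLeft_apply]
  exact this hf

lemma const_mem_affineSpan₁ {σ : ℝ → ℝ} (hσ : IsActivation σ) (r : ℝ) :
    (fun _ => r) ∈ affineSpan₁ σ := by
  obtain ⟨c, hc⟩ : ∃ c, σ c ≠ 0 := by
    rcases hσ with h | ⟨⟨s, t, hst⟩, -⟩
    · exact ⟨1, by simp [h]⟩
    · by_contra! h
      exact hst (by rw [h, h])
  convert (affineSpan₁ σ).smul_mem (r / σ c) (mem_affineSpan₁ σ 0 c) using 1
  ext s
  simp [hc]

/-- The span of the dilates of an activation function contains approximations of the unit step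
that are uniform away from the origin. -/
lemma exists_approx_step {σ : ℝ → ℝ} (hσ : IsActivation σ) {η : ℝ} (hη : 0 < η) :
    ∃ τ ∈ affineSpan₁ σ, (∀ u, 0 ≤ τ u ∧ τ u ≤ 1) ∧ (∀ u, 1 ≤ u → 1 - η ≤ τ u) ∧
      ∀ u, u ≤ -1 → τ u ≤ η := by
  have hconst := const_mem_affineSpan₁ hσ
  rcases hσ with h | ⟨⟨s, t, hst⟩, -, ⟨C, hC⟩, hmono⟩
  -- Two ReLUs give the ramp `(u + 1) / 2` clamped to `[0, 1]`, an exact step outside `(-1, 1)`.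
  · refine ⟨_, (affineSpan₁ σ).sub_mem (mem_affineSpan₁ σ (1 / 2) (1 / 2))
      (mem_affineSpan₁ σ (1 / 2) (-1 / 2)), fun u => ?_, fun u hu => ?_, fun u hu => ?_⟩ <;>
    simp only [Pi.sub_apply, h]
    · constructor <;> rcases max_cases (1 / 2 * u + 1 / 2) 0 with h1 | h1 <;>
        rcases max_cases (1 / 2 * u + -1 / 2) 0 with h2 | h2 <;> linarith
    · rw [max_eq_left (by linarith), max_eq_left (by linarith)]; linarith
    · rw [max_eq_right (by linarith), max_eq_right (by linarith)]; linarith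
  · have hba : BddAbove (Set.range σ) := ⟨C, by rintro _ ⟨u, rfl⟩; exact (abs_le.1 (hC u)).2⟩
    have hbb : BddBelow (Set.range σ) := ⟨-C, by rintro _ ⟨u, rfl⟩; exact (abs_le.1 (hC u)).1⟩
    set b := ⨆ u, σ u
    set a := ⨅ u, σ u
    have hle : ∀ u, σ u ≤ b := le_ciSup hba
    have hge : ∀ u, a ≤ σ u := ciInf_le hbb
    have hab : 0 < b - a := by
      rcases lt_or_gt_of_ne hst with h | h
      · linarith [hle t, hge s]
      · linarith [hle s, hge t]
    obtain ⟨u₁, hu₁⟩ : ∃ u₁, ∀ u ≥ u₁, b - η * (b - a) < σ u :=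
      eventually_atTop.1 ((tendsto_atTop_ciSup hmono hba).eventually_const_lt
        (by linarith [mul_pos hη hab]))
    obtain ⟨u₂, hu₂⟩ : ∃ u₂, ∀ u ≤ u₂, σ u < a + η * (b - a) :=
      eventually_atBot.1 ((tendsto_atBot_ciInf hmono hbb).eventually_lt_const
        (by linarith [mul_pos hη hab]))
    -- Dilating by `w` puts `|u| ≥ 1` in the tails, where `σ` is near its supremum or infimum.
    set w := max |u₁| |u₂|
    have hw0 : 0 ≤ w := (abs_nonneg _).trans (le_max_left _ _)
    refine ⟨_, (affineSpan₁ σ).smul_mem (b - a)⁻¹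
      ((affineSpan₁ σ).sub_mem (mem_affineSpan₁ σ w 0) (hconst a)),
      fun u => ⟨?_, ?_⟩, fun u hu => ?_, fun u hu => ?_⟩ <;>
    simp only [Pi.smul_apply, Pi.sub_apply, smul_eq_mul, add_zero, inv_mul_eq_div]
    · exact div_nonneg (by linarith [hge (w * u)]) hab.le
    · rw [div_le_one hab]; linarith [hle (w * u)]
    · rw [le_div_iff₀ hab]
      have : u₁ ≤ w * u := ((le_abs_self _).trans (le_max_left _ _)).trans
        (le_mul_of_one_le_right hw0 hu)
      linarith [hu₁ _ this]
    · rw [div_le_iff₀ hab]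
      have h1 : -w ≤ u₂ := by linarith [neg_abs_le u₂, le_max_right |u₁| |u₂|]
      have : w * u ≤ u₂ := by nlinarith
      linarith [hu₂ _ this]

/-- A function on `[0, N]` that varies by at most `ω` over unit distances is within `4 * ω` of
the span of the dilated translates of an activation function. -/
lemma exists_affineSpan₁_near_of_oscillation {σ : ℝ → ℝ} (hσ : IsActivation σ) (h : ℝ → ℝ) (N : ℕ)
    {ω : ℝ} (hω : ∀ u ∈ Set.Icc (0 : ℝ) N, ∀ v ∈ Set.Icc (0 : ℝ) N, |u - v| ≤ 1 →
      |h u - h v| ≤ ω) :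
    ∃ f ∈ affineSpan₁ σ, ∀ u ∈ Set.Icc (0 : ℝ) N, |h u - f u| ≤ 4 * ω := by
  obtain ⟨τ, hτ, hτ01, hτ1, hτ0⟩ :=
    exists_approx_step hσ (η := 1 / (N + 1)) (by positivity)
  have hω0 : 0 ≤ ω := by
    have := hω 0 ⟨le_rfl, by positivity⟩ 0 ⟨le_rfl, by positivity⟩ (by simp)
    simpa using this
  let d : ℕ → ℝ := fun i => h ((i + 1 : ℕ) : ℝ) - h i
  have hd : ∀ i < N, |d i| ≤ ω := fun i hi => by
    refine hω _ ⟨by positivity, by exact_mod_cast hi⟩ _ ⟨by positivity, by exact_mod_cast hi.le⟩ ?_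
    simp
  -- Staircase with a jump `d i` centred at `i + 1`. With `k = ⌊u⌋₊`, only the jumps `i = k` and `i
  -- + 1 = k` lie within distance 1 of `u`. They cost `ω` each, the other jumps at most `ω` together
  -- since `η = 1 / (N + 1)`, and replacing `h u` by `h k` costs the fourth `ω`.
  refine ⟨(fun _ => h 0) + ∑ i ∈ Finset.range N, d i • fun u => τ (1 * u + -(i + 1 : ℝ)),
    (affineSpan₁ σ).add_mem (const_mem_affineSpan₁ hσ _) ((affineSpan₁ σ).sum_mem fun i _ =>
      (affineSpan₁ σ).smul_mem _ (affineSpan₁_comp hτ _ _)), fun u hu => ?_⟩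
  set k := ⌊u⌋₊
  have hku : (k : ℝ) ≤ u := Nat.floor_le hu.1
  have huk : u < k + 1 := Nat.lt_floor_add_one u
  have hkN : k ≤ N := by exact_mod_cast hku.trans hu.2
  have htel : h k - h 0 = ∑ i ∈ Finset.range N, d i * if i < k then 1 else 0 := by
    simp only [mul_ite, mul_one, mul_zero]
    rw [← Finset.sum_filter]
    have : (Finset.range N).filter (· < k) = Finset.range k := by
      ext i
      simp only [Finset.mem_filter, Finset.mem_range]
      omega
    rw [this]
    have := Finset.sum_range_sub (fun i : ℕ => h i) k
    simpa [d] using this.symm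
  have hterm : ∀ i ∈ Finset.range N,
      |d i * ((if i < k then 1 else 0) - τ (1 * u + -(i + 1 : ℝ)))| ≤
        ω * (1 / (N + 1) + (if i = k then 1 else 0) + if i + 1 = k then 1 else 0) := by
    intro i hi
    rw [abs_mul]
    refine mul_le_mul (hd i (Finset.mem_range.1 hi)) ?_ (abs_nonneg _) hω0
    have hN : (0 : ℝ) < 1 / (N + 1) := by positivity
    obtain ⟨ha, hb⟩ := hτ01 (1 * u + -(i + 1 : ℝ))
    rcases lt_trichotomy i k with hik | hik | hik
    · have hne : i ≠ k := hik.ne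
      by_cases hik1 : i + 1 = k
      · rw [if_pos hik, if_neg hne, if_pos hik1, abs_le]
        constructor <;> linarith
      · have h2 : i + 2 ≤ k := by omega
        have h3 : (i : ℝ) + 2 ≤ k := by exact_mod_cast h2
        have := hτ1 (1 * u + -(i + 1 : ℝ)) (by linarith)
        rw [if_pos hik, if_neg hne, if_neg hik1, abs_le]
        constructor <;> linarith
    · have hne : ¬ i + 1 = k := by omega
      rw [if_neg (by omega), if_pos hik, if_neg hne, abs_le]
      constructor <;> linarith
    · have h3 : (k : ℝ) + 1 ≤ i := by exact_mod_cast hik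
      have := hτ0 (1 * u + -(i + 1 : ℝ)) (by linarith)
      rw [if_neg (by omega), if_neg (by omega), if_neg (by omega), abs_le]
      constructor <;> linarith
  have hsum : ∑ i ∈ Finset.range N,
      ω * (1 / ((N : ℝ) + 1) + (if i = k then 1 else 0) + if i + 1 = k then 1 else 0) ≤
        3 * ω := by
    rw [← Finset.mul_sum, mul_comm 3 ω]
    refine mul_le_mul_of_nonneg_left ?_ hω0
    rw [Finset.sum_add_distrib, Finset.sum_add_distrib]
    have h1 : ∑ _i ∈ Finset.range N, 1 / ((N : ℝ) + 1) ≤ 1 := by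
      rw [Finset.sum_const, Finset.card_range, nsmul_eq_mul, mul_one_div,
        div_le_one (by positivity)]
      linarith
    have h2 : ∑ i ∈ Finset.range N, (if i = k then (1 : ℝ) else 0) ≤ 1 := by
      rw [Finset.sum_ite_eq']
      split_ifs <;> norm_num
    have h3 : ∑ i ∈ Finset.range N, (if i + 1 = k then (1 : ℝ) else 0) ≤ 1 := by
      rw [Finset.sum_boole]
      exact_mod_cast Finset.card_le_one.2 fun a ha b hb => by
        have := (Finset.mem_filter.1 ha).2
        have := (Finset.mem_filter.1 hb).2
        omega
    linarith
  have hlast : |h u - h k| ≤ ω := by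
    refine hω u hu k ⟨by positivity, by exact_mod_cast hkN⟩ ?_
    rw [abs_le]
    constructor <;> linarith
  have hsplit : h u - ((fun _ => h 0 : ℝ → ℝ) +
      ∑ i ∈ Finset.range N, d i • fun u => τ (1 * u + -(i + 1 : ℝ))) u =
      (h u - h k) + ∑ i ∈ Finset.range N,
        d i * ((if i < k then 1 else 0) - τ (1 * u + -(i + 1 : ℝ))) := by
    simp only [mul_sub, Finset.sum_sub_distrib, ← htel, Pi.add_apply, Finset.sum_apply,
      Pi.smul_apply, smul_eq_mul]
    ring
  rw [hsplit]
  refine (abs_add_le _ _).trans ?_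
  have := (Finset.abs_sum_le_sum_abs _ _).trans ((Finset.sum_le_sum hterm).trans hsum)
  linarith

/-- Univariate universal approximation. -/
lemma exists_affineSpan₁_near {σ : ℝ → ℝ} (hσ : IsActivation σ) {h : ℝ → ℝ} (hh : Continuous h)
    {R : ℝ} (hR : 0 < R) {ε : ℝ} (hε : 0 < ε) :
    ∃ f ∈ affineSpan₁ σ, ∀ s ∈ Set.Icc (-R) R, |h s - f s| ≤ ε := by
  obtain ⟨δ, hδ, hhδ⟩ := Metric.uniformContinuousOn_iff.1
    (isCompact_Icc.uniformContinuousOn_of_continuous hh.continuousOn (s := Set.Icc (-R) R))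
    (ε / 4) (by positivity)
  obtain ⟨N, hN⟩ := exists_nat_gt (2 * R / δ)
  have hN0 : (0 : ℝ) < N := lt_of_le_of_lt (by positivity) hN
  set a := 2 * R / N
  have ha0 : 0 < a := by positivity
  have haδ : a < δ := by
    rw [div_lt_iff₀ hδ] at hN
    rw [div_lt_iff₀ hN0]
    linarith
  have haN : a * N = 2 * R := div_mul_cancel₀ _ hN0.ne'
  have hmem : ∀ u ∈ Set.Icc (0 : ℝ) N, a * u + -R ∈ Set.Icc (-R) R := fun u hu => by
    have h1 := mul_nonneg ha0.le hu.1
    have h2 := mul_le_mul_of_nonneg_left hu.2 ha0.le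
    constructor <;> linarith
  obtain ⟨f, hf, hfh⟩ := exists_affineSpan₁_near_of_oscillation hσ (fun u => h (a * u + -R)) N
    (ω := ε / 4) fun u hu v hv huv => by
      refine (hhδ _ (hmem u hu) _ (hmem v hv) ?_).le
      rw [Real.dist_eq, show a * u + -R - (a * v + -R) = a * (u - v) by ring, abs_mul,
        abs_of_pos ha0]
      exact (mul_le_of_le_one_right ha0.le huv).trans_lt haδ
  refine ⟨_, affineSpan₁_comp hf a⁻¹ (R / a), fun s hs => ?_⟩
  have hs' : a * (a⁻¹ * s + R / a) + -R = s := by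
    field_simp
    ring
  have := hfh (a⁻¹ * s + R / a) ⟨?_, ?_⟩
  · rw [hs'] at this
    linarith
  · rw [inv_mul_eq_div, ← add_div]
    exact div_nonneg (by linarith [hs.1]) ha0.le
  · rw [inv_mul_eq_div, ← add_div, div_le_iff₀ ha0]
    linarith [hs.2]

/-! ### Several variables, through Stone–Weierstrass -/

/-- The exponential ridge function `x ↦ exp (b ⬝ᵥ x)` restricted to `X`. -/
noncomputable def expRidge {p : ℕ} (X : Set (Fin p → ℝ)) (b : Fin p → ℝ) : C(X, ℝ) :=
  ⟨fun x => Real.exp (b ⬝ᵥ (x : Fin p → ℝ)),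
    Real.continuous_exp.comp (continuous_const.dotProduct continuous_subtype_val)⟩

/-- Products of exponentials add exponents, so the generators already form a monoid. Density of the
algebra thus becomes density of linear combinations of single ridge functions. -/
lemma adjoin_expRidge {p : ℕ} (X : Set (Fin p → ℝ)) :
    Subalgebra.toSubmodule (Algebra.adjoin ℝ (Set.range (expRidge X))) =
      Submodule.span ℝ (Set.range (expRidge X)) := by
  let S : Submonoid C(X, ℝ) :=
    { carrier := Set.range (expRidge X)
      one_mem' := ⟨0, by ext x; simp [expRidge]⟩
      mul_mem' := by
        rintro _ _ ⟨b, rfl⟩ ⟨c, rfl⟩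
        exact ⟨b + c, by ext x; simp [expRidge, Real.exp_add]⟩ }
  exact Algebra.adjoin_eq_span_of_subset ℝ
    fun _ hg =>
    Submodule.subset_span ((Submonoid.closure_le (S := S)).2 subset_rfl hg)

lemma separatesPoints_adjoin_expRidge {p : ℕ} (X : Set (Fin p → ℝ)) :
    (Algebra.adjoin ℝ (Set.range (expRidge X))).SeparatesPoints := by
  intro x y hxy
  obtain ⟨i, hi⟩ : ∃ i, (x : Fin p → ℝ) i ≠ (y : Fin p → ℝ) i := by
    by_contra! h
    exact hxy (Subtype.ext (funext h))
  refine ⟨_, ⟨expRidge X (Pi.single i 1), Algebra.subset_adjoin ⟨_, rfl⟩, rfl⟩, ?_⟩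
  simpa [expRidge] using hi

/-- Universal approximation on compact sets by linear combinations of ridge functions. -/
lemma exists_ridgeSpan_near {σ : ℝ → ℝ} (hσ : IsActivation σ) {p : ℕ} {X : Set (Fin p → ℝ)}
    (hX : IsCompact X) (φ : C(X, ℝ)) {ε : ℝ} (hε : 0 < ε) :
    ∃ f ∈ ridgeSpan σ p, ∀ x : X, |φ x - f x| ≤ ε := by
  have := isCompact_iff_compactSpace.1 hX
  obtain ⟨⟨g, hg⟩, hgφ⟩ :=
    ContinuousMap.exists_mem_subalgebra_near_continuousMap_of_separatesPoints _
      (separatesPoints_adjoin_expRidge X) φ (ε / 2) (by positivity)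
  change ‖g - φ‖ < ε / 2 at hgφ
  rw [← Subalgebra.mem_toSubmodule, adjoin_expRidge] at hg
  -- The tolerance is quantified inside the induction because sums and scalar multiples must shrink
  -- it.
  have key : ∀ ε > 0, ∃ f ∈ ridgeSpan σ p, ∀ x : X, |g x - f x| ≤ ε := by
    clear hgφ
    induction hg using Submodule.span_induction with
    | mem g hg =>
      obtain ⟨b, rfl⟩ := hg
      intro ε hε
      obtain ⟨R, hR⟩ := hX.exists_bound_of_continuousOn
        (f := fun x : Fin p → ℝ => b ⬝ᵥ x) (by simp only [dotProduct]; fun_prop)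
      obtain ⟨f, hf, hfe⟩ := exists_affineSpan₁_near hσ Real.continuous_exp
        (R := max R 1) (by positivity) hε
      refine ⟨_, ridgeSpan_comp hf b, fun x => hfe _ (abs_le.1 ?_)⟩
      exact (hR x x.2).trans (le_max_left _ _)
    | zero => exact fun ε hε => ⟨0, Submodule.zero_mem _, fun x => by simpa using hε.le⟩
    | add g₁ g₂ _ _ h₁ h₂ =>
      intro ε hε
      obtain ⟨f₁, hf₁, h₁⟩ := h₁ (ε / 2) (by positivity)
      obtain ⟨f₂, hf₂, h₂⟩ := h₂ (ε / 2) (by positivity)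
      refine ⟨f₁ + f₂, Submodule.add_mem _ hf₁ hf₂, fun x => ?_⟩
      have e : (g₁ + g₂) x - (f₁ + f₂) x = (g₁ x - f₁ x) + (g₂ x - f₂ x) := by
        simp only [ContinuousMap.add_apply, Pi.add_apply]; ring
      rw [e]
      linarith [abs_add_le (g₁ x - f₁ x) (g₂ x - f₂ x), h₁ x, h₂ x]
    | smul r g _ h =>
      intro ε hε
      obtain ⟨f, hf, h⟩ := h (ε / (|r| + 1)) (by positivity)
      refine ⟨r • f, Submodule.smul_mem _ _ hf, fun x => ?_⟩
      rw [ContinuousMap.smul_apply, Pi.smul_apply, ← smul_sub, smul_eq_mul, abs_mul]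
      have h2 : (|r| + 1) * (ε / (|r| + 1)) = ε := mul_div_cancel₀ _ (by positivity)
      nlinarith [h x, abs_nonneg r, abs_nonneg (g x - f x)]
  obtain ⟨f, hf, hfg⟩ := key (ε / 2) (by positivity)
  refine ⟨f, hf, fun x => ?_⟩
  have h1 : |g x - φ x| ≤ ε / 2 := ((g - φ).norm_coe_le_norm x).trans hgφ.le
  rw [abs_sub_comm] at h1
  linarith [abs_sub_le (φ x) (g x) (f x), hfg x]

/-- Finitely many elements of `ridgeSpan` are the coordinates of a two-layer network, of every
sufficiently large width. -/
lemma exists_twoLayerNet_eq {σ : ℝ → ℝ} {p K : ℕ} {f : Fin K → (Fin p → ℝ) → ℝ}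
    (hf : ∀ l, f l ∈ ridgeSpan σ p) :
    ∃ T₀ : ℕ, ∀ T ≥ T₀, ∃ (A : Matrix (Fin K) (Fin T) ℝ) (B : Matrix (Fin T) (Fin p) ℝ)
      (c : Fin T → ℝ), ∀ x l, twoLayerNet σ A B c x l = f l x := by
  have hrep : ∀ l, ∃ (n : ℕ) (a : Fin n → ℝ) (q : Fin n → (Fin p → ℝ) × ℝ),
      ∀ x, f l x = ∑ i, a i * σ ((q i).1 ⬝ᵥ x + (q i).2) := by
    intro l
    obtain ⟨n, a, g, hg⟩ := Submodule.mem_span_set'.1 (hf l)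
    choose q hq using fun i => (g i).2
    refine ⟨n, a, q, fun x => ?_⟩
    rw [← hg, Finset.sum_apply]
    exact Finset.sum_congr rfl fun i _ => by rw [Pi.smul_apply, ← hq i, smul_eq_mul]
  choose n a q hrep using hrep
  let ι := Σ l, Fin (n l)
  refine ⟨Fintype.card ι, fun T hT => ?_⟩
  obtain ⟨e⟩ : Nonempty (ι ↪ Fin T) :=
    Function.Embedding.nonempty_of_card_le (by simpa using hT)
  -- Each output reads only its own block of hidden units; surplus units have outgoing weight 0, so
  -- the value `σ 0` is harmless.
  refine ⟨fun l => Function.extend e (fun i : ι => if i.1 = l then a i.1 i.2 else 0) 0,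
    Function.extend e (fun i : ι => (q i.1 i.2).1) 0,
    Function.extend e (fun i : ι => (q i.1 i.2).2) 0, fun x l => ?_⟩
  simp only [twoLayerNet, Matrix.mulVec, dotProduct, Pi.add_apply]
  rw [← Finset.sum_subset (Finset.subset_univ (Finset.univ.map e))]
  · rw [Finset.sum_map]
    simp only [e.injective.extend_apply]
    rw [Fintype.sum_sigma, Finset.sum_eq_single l]
    · simp [hrep, dotProduct]
    · intro m _ hm
      simp [hm]
    · simp
  · intro t _ ht
    rw [Function.extend_apply']
    · simp
    · simpa using ht

/-- Continuous feature maps on a compact set can be replaced by two-layer networks without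
changing their inner products much. -/
lemma exists_twoLayerNet_near {σ : ℝ → ℝ} (hσ : IsActivation σ) {p K : ℕ} {X : Set (Fin p → ℝ)}
    (hX : IsCompact X) (φ : Fin K → C(X, ℝ)) {ε : ℝ} (hε : 0 < ε) :
    ∃ T₀ : ℕ, ∀ T ≥ T₀, ∃ (A : Matrix (Fin K) (Fin T) ℝ) (B : Matrix (Fin T) (Fin p) ℝ)
      (c : Fin T → ℝ), ∀ x x' : X,
        |∑ l, φ l x * φ l x' - twoLayerNet σ A B c x ⬝ᵥ twoLayerNet σ A B c x'| ≤ ε := by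
  have := isCompact_iff_compactSpace.1 hX
  set C := ∑ l, ‖φ l‖
  have hC0 : 0 ≤ C := Finset.sum_nonneg fun l _ => norm_nonneg _
  have hC : ∀ l x, |φ l x| ≤ C := fun l x => ((φ l).norm_coe_le_norm x).trans
    (Finset.single_le_sum (f := fun l => ‖φ l‖) (fun l _ => norm_nonneg _) (Finset.mem_univ l))
  -- Replacing both factors costs `2 * C * δ + δ ^ 2` per coordinate, and `δ ≤ 1` absorbs the
  -- square.
  set δ := min 1 (ε / ((K + 1) * (2 * C + 1)))
  have hδ : 0 < δ := by positivity
  have hδ1 : δ ≤ 1 := min_le_left _ _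
  have hδε : K * (δ * (2 * C + 1)) ≤ ε := by
    have h := min_le_right 1 (ε / ((K + 1) * (2 * C + 1)))
    rw [le_div_iff₀ (by positivity)] at h
    have : 0 ≤ δ * (2 * C + 1) := by positivity
    change δ * _ ≤ ε at h
    linarith
  choose f hf hfφ using fun l => exists_ridgeSpan_near hσ hX (φ l) hδ
  obtain ⟨T₀, hT₀⟩ := exists_twoLayerNet_eq hf
  refine ⟨T₀, fun T hT => ?_⟩
  obtain ⟨A, B, c, hnet⟩ := hT₀ T hT
  refine ⟨A, B, c, fun x x' => ?_⟩
  simp only [dotProduct, hnet]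
  rw [← Finset.sum_sub_distrib]
  have hterm : ∀ l ∈ Finset.univ, |φ l x * φ l x' - f l x * f l x'| ≤ δ * (2 * C + 1) := by
    intro l _
    have e : φ l x * φ l x' - f l x * f l x' = φ l x * (φ l x' - f l x') +
        (φ l x - f l x) * φ l x' - (φ l x - f l x) * (φ l x' - f l x') := by ring
    have h1 := mul_le_mul (hC l x) (hfφ l x') (abs_nonneg _) hC0
    have h2 := mul_le_mul (hfφ l x) (hC l x') (abs_nonneg _) hδ.le
    have h3 := mul_le_mul (hfφ l x) ((hfφ l x').trans hδ1) (abs_nonneg _) hδ.le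
    rw [← abs_mul] at h1 h2 h3
    rw [e]
    refine (abs_sub _ _).trans ?_
    linarith [abs_add_le (φ l x * (φ l x' - f l x')) ((φ l x - f l x) * φ l x')]
  refine (Finset.abs_sum_le_sum_abs _ _).trans ((Finset.sum_le_sum hterm).trans ?_)
  simpa using hδε

/-! ### Kernels on the cube and the final assembly -/

lemma isCompact_cube (p : ℕ) (M : ℝ) : IsCompact (cube p M) := by
  have : cube p M = Set.univ.pi fun _ => Set.Icc (-M) M := by
    ext x
    exact Set.mem_univ_pi.symm
  rw [this]
  exact isCompact_univ_pi fun _ => isCompact_Icc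

/-- A positive definite kernel on a compact set is uniformly approximated by the inner product
similarity of two-layer networks. -/
lemma IsPDKernel.exists_twoLayerNet_near {σ : ℝ → ℝ} (hσ : IsActivation σ) {p : ℕ}
    {X : Set (Fin p → ℝ)} (hX : IsCompact X) {k : X → X → ℝ} (hk : IsPDKernel k) {ε : ℝ}
    (hε : 0 < ε) :
    ∃ (K₀ : ℕ) (T₀ : ℕ → ℕ), ∀ K ≥ K₀, ∀ T ≥ T₀ K,
      ∃ (A : Matrix (Fin K) (Fin T) ℝ) (B : Matrix (Fin T) (Fin p) ℝ) (c : Fin T → ℝ),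
        ∀ x x' : X, |k x x' - twoLayerNet σ A B c x ⬝ᵥ twoLayerNet σ A B c x'| ≤ ε := by
  have := isCompact_iff_compactSpace.1 hX
  obtain ⟨K₀, hK₀⟩ := hk.exists_features (half_pos hε)
  have : ∀ K, ∃ T₀ : ℕ, K ≥ K₀ → ∀ T ≥ T₀,
      ∃ (A : Matrix (Fin K) (Fin T) ℝ) (B : Matrix (Fin T) (Fin p) ℝ) (c : Fin T → ℝ),
        ∀ x x' : X, |k x x' - twoLayerNet σ A B c x ⬝ᵥ twoLayerNet σ A B c x'| ≤ ε := by
    intro K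
    by_cases hK : K ≥ K₀
    · obtain ⟨φ, hφ⟩ := hK₀ K hK
      obtain ⟨T₀, hT₀⟩ := _root_.exists_twoLayerNet_near hσ hX φ (half_pos hε)
      refine ⟨T₀, fun _ T hT => ?_⟩
      obtain ⟨A, B, c, h⟩ := hT₀ T hT
      refine ⟨A, B, c, fun x x' => ?_⟩
      linarith [hφ x x', h x x', abs_sub_le (k x x') (∑ l, φ l x * φ l x')
        (twoLayerNet σ A B c x ⬝ᵥ twoLayerNet σ A B c x')]
    · exact ⟨0, fun h => absurd h hK⟩
  choose T₀ hT₀ using this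
  exact ⟨K₀, T₀, fun K hK => hT₀ K hK⟩

theorem theoremA1 (p Kstar : ℕ) (hKstar : 0 < Kstar) (M : ℝ) (hM : 0 < M)
    (Y : Set (Fin Kstar → ℝ)) (hY : IsClosed Y)
    (fstar : cube p M → Y) (hf : Continuous fstar)
    (gstar : Y → Y → ℝ) (hg : IsKernel gstar) (hdom : IsPDDominated gstar)
    (σ : ℝ → ℝ) (hσ : IsActivation σ) (ε : ℝ) (hε : 0 < ε) :
    ∃ (K₀ K₀' : ℕ) (T₀ T₀' : ℕ → ℕ),
      ∀ Kp ≥ K₀, ∀ Km ≥ K₀', ∀ Tp ≥ T₀ Kp, ∀ Tm ≥ T₀' Km,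
        ∃ (A : Matrix (Fin Kp) (Fin Tp) ℝ) (B : Matrix (Fin Tp) (Fin p) ℝ) (c : Fin Tp → ℝ)
          (E : Matrix (Fin Km) (Fin Tm) ℝ) (F : Matrix (Fin Tm) (Fin p) ℝ) (o : Fin Tm → ℝ),
          ∀ x x' : cube p M,
            |gstar (fstar x) (fstar x') -
              (twoLayerNet σ A B c x ⬝ᵥ twoLayerNet σ A B c x' -
                twoLayerNet σ E F o x ⬝ᵥ twoLayerNet σ E F o x')| < ε := by
  obtain ⟨g, hgPD, hdiff⟩ := hdom
  have hX := isCompact_cube p M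
  -- Two errors of `ε / 3` leave room for the strict inequality.
  obtain ⟨K₀, T₀, hp⟩ := (hgPD.comp hf).exists_twoLayerNet_near hσ hX (ε := ε / 3) (by positivity)
  obtain ⟨K₀', T₀', hm⟩ :=
    (hdiff.comp hf).exists_twoLayerNet_near hσ hX (ε := ε / 3) (by positivity)
  refine ⟨K₀, K₀', T₀, T₀', fun Kp hKp Km hKm Tp hTp Tm hTm => ?_⟩
  obtain ⟨A, B, c, h₁⟩ := hp Kp hKp Tp hTp
  obtain ⟨E, F, o, h₂⟩ := hm Km hKm Tm hTm
  refine ⟨A, B, c, E, F, o, fun x x' => ?_⟩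
  have h₁ := abs_le.1 (h₁ x x')
  have h₂ := abs_le.1 (h₂ x x')
  rw [abs_lt]
  constructor <;> linarith [h₁.1, h₁.2, h₂.1, h₂.2]
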